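/- Let $s\ge 1$, $\gamma\in[0,1]$, $\alpha\in(0,1)$, and let $0\le\alpha_1\le\alpha_2\le\dots\le\alpha_s$ be constants with $\alpha_s>0$. Data $X$ have a distribution $P$ in some model $\Omega$; for $i=1,\dots,s$ the null hypothesis $H_i$ is $P\in\omega_i$, where $\omega_i\subseteq\Omega$, and $I(P)=\{i: P\in\omega_i\}$ is the set of true null hypotheses. Real-valued statistics $\hat p_1,\dots,\hat p_s$ of the data are called valid p-values if $P\{\hat p_i\le u\}\le u$ for all $i$, all $u\in(0,1)$ and all $P\in\omega_i$; nothing is assumed about their joint distribution. The stepup procedure with critical values $c_1\le\dots\le c_s$ orders the p-values as $\hat p_{(1)}\le\dots\le\hat p_{(s)}$, with corresponding hypotheses $H_{(1)},\dots,H_{(s)}$, and rejects $H_{(1)},\dots,H_{(r)}$, where $r\in\{0,\dots,s\}$ is the smallest index such that $\hat p_{(j)}>c_j$ for all $j$ with $r<j\le s$. The false discovery proportion FDP is the number of rejected true hypotheses divided by the number of rejected hypotheses, and is $0$ if nothing is rejected. The procedure controls the FDP if $$P\{\mathrm{FDP}>\gamma\}\le\alpha\quad\text{for every }P\in\Omega.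 \tag{1}$$ Put $m(j)=\lfloor\gamma j\rfloor+1$ and, for $1\le n\le s$, $$S_2(\gamma,s,n)=n\,\alpha_1+n\sum_{\substack{n-s+1<k\le n\\ m(s-n+k)\le n}}\frac{\alpha_{s-n+k}-\alpha_{s-n+k-1}}{\max\{k,\,m(s-n+k)\}},\qquad D_2=D_2(\gamma,s)=\max_{1\le n\le s}S_2(\gamma,s,n),$$ where $k$ ranges over integers. If $\gamma<1$, then $D_2>0$. Moreover: (i) For every model, all null hypotheses and all valid p-values, the stepup procedure with critical values $\alpha_i''=\alpha\alpha_i/D_2$ satisfies (1). (If $\gamma=1$ and $D_2=0$, read $\alpha_i''=0$.) (ii) Let $\gamma<1$ and $D'>0$. If the stepup procedure with critical values $\tilde\alpha_i=\alpha\alpha_i/D'$ satisfies (1) for all models, all null hypotheses and all valid p-values with values in $[0,1]$, then $D'\ge D_2$, and hence $\alpha_i''\ge\tilde\alpha_i$ for each $i=1,\dots,s$. -/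

import Mathlib

open MeasureTheory

/-- The setup: the data take values in the sample space `𝒳`, `model` is the set of possible
distributions `P` of the data, the `i`-th null hypothesis states `P ∈ null i`, and
`pval i` is the statistic used as p-value for the `i`-th hypothesis. Nothing is assumed on the
dependence among the p-values. -/
structure TestingProblem (s : ℕ) (𝒳 : Type*) [MeasurableSpace 𝒳] where
  /-- the model -/
  model : Set (ProbabilityMeasure 𝒳)
  /-- the null hypotheses, as subsets of the model -/
  null : Fin s → Set (ProbabilityMeasure 𝒳)
  null_subset : ∀ i, null i ⊆ model
  /-- the p-values, as functions of the data -/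
  pval : Fin s → 𝒳 → ℝ
  measurable_pval : ∀ i, Measurable (pval i)

namespace TestingProblem

variable {s : ℕ} {𝒳 : Type*} [MeasurableSpace 𝒳]

/-- The set `I(P)` of (indices of) true null hypotheses when `P` is the true distribution. -/
def trueNulls (T : TestingProblem s 𝒳) (P : ProbabilityMeasure 𝒳) : Set (Fin s) :=
  {i | P ∈ T.null i}

/-- Marginal validity of the p-values: `P {p_i ≤ u} ≤ u` for all `u ∈ (0,1)` and `P` in the
`i`-th null hypothesis. -/
def ValidPValues (T : TestingProblem s 𝒳) : Prop :=
  ∀ i, ∀ P ∈ T.null i, ∀ u ∈ Set.Ioo (0 : ℝ) 1,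
    (P : Measure 𝒳).real {x | T.pval i x ≤ u} ≤ u

end TestingProblem

namespace StepUp

/-- The order statistics: `orderStat p j` is the `(j+1)`-st smallest of `p 0, …, p (s-1)`
(the index `j : Fin s` counts from zero). -/
noncomputable def orderStat {s : ℕ} (p : Fin s → ℝ) (j : Fin s) : ℝ := p (Tuple.sort p j)

/-- The number of hypotheses rejected by the stepup procedure with critical values
`c 1, …, c s`: the smallest `r` with `p_(s) > c s, …, p_(r+1) > c (r+1)`. It is `s` if
`p_(s) ≤ c s`, and `0` if `p_(j) > c j` for all `j`. -/
noncomputable def numRejected {s : ℕ} (c : ℕ → ℝ) (p : Fin s → ℝ) : ℕ :=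
  sInf {r : ℕ | ∀ j : Fin s, r ≤ (j : ℕ) → c ((j : ℕ) + 1) < orderStat p j}

/-- The hypotheses `H_(1), …, H_(r)` rejected by the stepup procedure, `r = numRejected c p`. -/
noncomputable def rejected {s : ℕ} (c : ℕ → ℝ) (p : Fin s → ℝ) : Finset (Fin s) :=
  (Finset.univ.filter fun j : Fin s => (j : ℕ) < numRejected c p).image (Tuple.sort p)

open Classical in
/-- The false discovery proportion of the stepup procedure with critical values `c`, when `I` is
the set of true hypotheses and `p` the vector of p-values. -/
noncomputable def fdp {s : ℕ} (c : ℕ → ℝ) (I : Set (Fin s)) (p : Fin s → ℝ) : ℝ :=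
  if (rejected c p).card = 0 then 0
  else (((rejected c p).filter fun i => i ∈ I).card : ℝ) / ((rejected c p).card : ℝ)

/-- `P {FDP > γ} ≤ α` for every distribution `P` of the model, for the stepup procedure with
critical values `c`. -/
def ControlsFDP {s : ℕ} {𝒳 : Type*} [MeasurableSpace 𝒳] (c : ℕ → ℝ) (γ α : ℝ)
    (T : TestingProblem s 𝒳) : Prop :=
  ∀ P ∈ T.model,
    (P : Measure 𝒳).real {x | γ < fdp c (T.trueNulls P) (fun i => T.pval i x)} ≤ α

/-- `m(j) = ⌊γ j⌋ + 1`. -/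
noncomputable def m (γ : ℝ) (j : ℕ) : ℤ := ⌊γ * (j : ℝ)⌋ + 1

/-- The quantity
`S₂(γ, s, n) = n a_1 + n ∑_k (a_{s-n+k} - a_{s-n+k-1}) / max {k, m(s-n+k)}`, the sum being over
the integers `n - s + 1 < k ≤ n` with `n ≥ m(s-n+k)`. It is written with the summation index
`j = s - n + k`, which runs over `2, …, s`, so that `k = j - s + n`. -/
noncomputable def S2 (a : ℕ → ℝ) (γ : ℝ) (s n : ℕ) : ℝ :=
  (n : ℝ) * a 1 + (n : ℝ) * ∑ j ∈ (Finset.Icc 2 s).filter (fun j : ℕ => m γ j ≤ (n : ℤ)),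
    (a j - a (j - 1)) / ((max ((j : ℤ) - (s : ℤ) + (n : ℤ)) (m γ j) : ℤ) : ℝ)

/-- `D₂(γ, s) = max_{1 ≤ n ≤ s} S₂(γ, s, n)`. -/
noncomputable def D2 (a : ℕ → ℝ) (γ : ℝ) (s : ℕ) (hs : 1 ≤ s) : ℝ :=
  (Finset.Icc 1 s).sup' (Finset.nonempty_Icc.2 hs) (fun n => S2 a γ s n)

end StepUp

/-! Suppose n of the s hypotheses are true and let N_j count the true p-values at most c_j. If r
hypotheses are rejected and FDP > γ, at least k_r = max{r-s+n, m(r)} of them are true, as only s-n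
are false; hence N_r ≥ k_r and m(r) ≤ n. With weights w_j = 1/k_j, cut to 0 when m(j) > n, this says
N_r w_r ≥ 1. Since w is antitone, summation by parts (`mul_le_sum_increments_mul`) gives 1 ≤ Σ (N_j
- N_{j-1}) w_j, and Markov's inequality bounds P{FDP > γ} by the expectation of this sum. Validity
gives E N_j ≤ n c_j, and a second summation by parts replaces E N_j by n c_j (`real_lt_fdp_le`). For
c = βa the bound is β S₂(n). Only expectations of sums of indicators enter, so the dependence is
irrelevant.

The bound is attained (`exists_le_real_lt_fdp`). A layer of mass nβ(a_j - a_{j-1}) w_j has exactly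
k_j true p-values equal to βa_j, picked by a uniformly rotated cyclic window, and enough false ones
equal to 0 to force j rejections. Each layer with m(j) ≤ n gives every true p-value mass β(a_j -
a_{j-1}) at βa_j, which is valid by telescoping. If D' < D₂, the maximising n yields a probability
above α. -/

open Finset in
/-- Summation by parts: a nonnegative sequence tested against antitone weights. -/
theorem mul_le_sum_increments_mul (d w : ℕ → ℝ) (n : ℕ) (hd : ∀ r ≤ n, 0 ≤ d r) (hd0 : d 0 = 0)
    (hw : ∀ r, 1 ≤ r → r < n → w (r + 1) ≤ w r) :
    d n * w n ≤ ∑ r ∈ range n, (d (r + 1) - d r) * w (r + 1) := by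
  induction n with
  | zero => simp [hd0]
  | succ n ih =>
    rw [sum_range_succ]
    have h1 := ih (fun r hr => hd r (by omega)) (fun r h1 h2 => hw r h1 (by omega))
    have h2 : d n * w (n + 1) ≤ d n * w n := by
      rcases Nat.eq_zero_or_pos n with rfl | hn
      · simp [hd0]
      · exact mul_le_mul_of_nonneg_left (hw n hn (by omega)) (hd n (by omega))
    linarith

namespace StepUp

open Finset

/-! ### The weights in `S₂` -/

theorem one_le_m {γ : ℝ} (hγ : 0 ≤ γ) (j : ℕ) : 1 ≤ m γ j := by
  have : 0 ≤ ⌊γ * (j : ℝ)⌋ := Int.floor_nonneg.2 (by positivity)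
  unfold m; omega

theorem m_mono {γ : ℝ} (hγ : 0 ≤ γ) : Monotone (m γ) := by
  intro i j hij
  have : ⌊γ * (i : ℝ)⌋ ≤ ⌊γ * (j : ℝ)⌋ :=
    Int.floor_le_floor (mul_le_mul_of_nonneg_left (by exact_mod_cast hij) hγ)
  unfold m; omega

theorem m_le_self {γ : ℝ} (hγ : γ < 1) {j : ℕ} (hj : 1 ≤ j) : m γ j ≤ j := by
  have hj' : (0 : ℝ) < j := by exact_mod_cast hj
  have : ⌊γ * (j : ℝ)⌋ < (j : ℤ) := Int.floor_lt.2 (by push_cast; nlinarith)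
  unfold m; omega

theorem m_le_iff {γ : ℝ} {j f : ℕ} : m γ j ≤ f ↔ γ * j < f := by
  unfold m
  rw [Int.add_one_le_iff, Int.floor_lt]
  simp

/-- `max {j - s + n, m(j)}`: the least number of true hypotheses among `j` rejected ones if
`FDP > γ` and `n` of the `s` hypotheses are true. -/
noncomputable def minFalse (γ : ℝ) (s n j : ℕ) : ℤ := max ((j : ℤ) - s + n) (m γ j)

/-- The coefficient of `n (a_j - a_{j-1})` in `S₂(γ, s, n)`. -/
noncomputable def weight (γ : ℝ) (s n j : ℕ) : ℝ :=
  if m γ j ≤ (n : ℤ) then (minFalse γ s n j : ℝ)⁻¹ else 0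

theorem one_le_minFalse {γ : ℝ} (hγ : 0 ≤ γ) (s n j : ℕ) : 1 ≤ minFalse γ s n j :=
  (one_le_m hγ j).trans (le_max_right _ _)

theorem weight_nonneg {γ : ℝ} (hγ : 0 ≤ γ) (s n j : ℕ) : 0 ≤ weight γ s n j := by
  have := one_le_minFalse hγ s n j
  unfold weight
  split_ifs
  · exact inv_nonneg.2 (by exact_mod_cast (by omega : 0 ≤ minFalse γ s n j))
  · rfl

/-- The cutoff m(j) > n removes a final segment of indices because m is monotone, so it only helps.
-/
theorem weight_antitone {γ : ℝ} (hγ : 0 ≤ γ) (s n : ℕ) : Antitone (weight γ s n) := by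
  intro i j hij
  have hm := m_mono hγ hij
  by_cases h : m γ j ≤ (n : ℤ)
  · have hk : minFalse γ s n i ≤ minFalse γ s n j := max_le_max (by omega) hm
    have := one_le_minFalse hγ s n i
    rw [weight, weight, if_pos h, if_pos (hm.trans h)]
    exact inv_anti₀ (by exact_mod_cast (by omega : 0 < minFalse γ s n i)) (by exact_mod_cast hk)
  · rw [weight, if_neg h]
    exact weight_nonneg hγ s n i

theorem weight_one {γ : ℝ} (hγ0 : 0 ≤ γ) (hγ1 : γ < 1) {s n : ℕ} (hn : 1 ≤ n) (hns : n ≤ s) :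
    weight γ s n 1 = 1 := by
  have h1 := one_le_m hγ0 1
  have h2 := m_le_self hγ1 le_rfl
  have h3 : minFalse γ s n 1 = 1 := by unfold minFalse; push_cast at h2 ⊢; omega
  rw [weight, if_pos (by push_cast at h2; omega), h3]
  simp

/-- The critical values, extended by `0` at the index `0`. -/
def extend (a : ℕ → ℝ) (j : ℕ) : ℝ := if j = 0 then 0 else a j

theorem extend_succ (a : ℕ → ℝ) (j : ℕ) : extend a (j + 1) = a (j + 1) := rfl

theorem extend_mono {a : ℕ → ℝ} {s : ℕ} (ha : MonotoneOn a (Set.Icc 1 s)) (ha1 : 0 ≤ a 1)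
    {i j : ℕ} (hij : i ≤ j) (hj : j ≤ s) : extend a i ≤ extend a j := by
  unfold extend
  split_ifs with h1 h2 h2
  · rfl
  · exact ha1.trans (ha ⟨le_rfl, by omega⟩ ⟨by omega, hj⟩ (by omega))
  · omega
  · exact ha ⟨by omega, by omega⟩ ⟨by omega, hj⟩ hij

/-- The isolated term n a_1 is the j = 1 term: the weight there is 1, as ⌊γ⌋ = 0, and the extended
sequence starts at 0. -/
theorem S2_eq (a : ℕ → ℝ) {γ : ℝ} (hγ0 : 0 ≤ γ) (hγ1 : γ < 1) {s n : ℕ} (hn : 1 ≤ n)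
    (hns : n ≤ s) :
    S2 a γ s n =
      n * ∑ r ∈ range s, (extend a (r + 1) - extend a r) * weight γ s n (r + 1) := by
  obtain ⟨t, rfl⟩ : ∃ t, s = t + 1 := ⟨s - 1, by omega⟩
  rw [sum_range_succ', weight_one hγ0 hγ1 hn hns, S2, sum_filter, mul_add]
  have h : ∑ r ∈ range t, (extend a (r + 1 + 1) - extend a (r + 1)) * weight γ (t + 1) n (r + 1 + 1)
      = ∑ j ∈ Icc 2 (t + 1), if m γ j ≤ (n : ℤ) then
        (a j - a (j - 1)) / ((max ((j : ℤ) - ((t + 1 : ℕ) : ℤ) + (n : ℤ)) (m γ j) : ℤ) : ℝ)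
        else 0 := by
    rw [← Finset.Ico_add_one_right_eq_Icc, Finset.sum_Ico_eq_sum_range]
    refine sum_congr (by congr 1) fun r _ => ?_
    rw [show 2 + r = r + 1 + 1 by omega, weight, minFalse, extend_succ, extend_succ]
    split_ifs <;> simp [div_eq_mul_inv]
  rw [h, extend_succ]
  simp [extend]
  ring

theorem S2_le_D2 (a : ℕ → ℝ) (γ : ℝ) {s n : ℕ} (hs : 1 ≤ s) (hn : 1 ≤ n) (hns : n ≤ s) :
    S2 a γ s n ≤ D2 a γ s hs :=
  le_sup' (fun n => S2 a γ s n) (mem_Icc.2 ⟨hn, hns⟩)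

/-- Already n = s suffices: summation by parts bounds the sum below by a_s times the last weight,
which is positive since m(s) ≤ s. -/
theorem D2_pos {a : ℕ → ℝ} {γ : ℝ} {s : ℕ} (hs : 1 ≤ s) (hγ0 : 0 ≤ γ) (hγ1 : γ < 1)
    (ha : MonotoneOn a (Set.Icc 1 s)) (ha1 : 0 ≤ a 1) (has : 0 < a s) : 0 < D2 a γ s hs := by
  refine lt_of_lt_of_le ?_ (S2_le_D2 a γ hs hs le_rfl)
  rw [S2_eq a hγ0 hγ1 hs le_rfl]
  have hsum := mul_le_sum_increments_mul (extend a) (weight γ s s) s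
    (fun r hr => by simpa [extend] using extend_mono ha ha1 (Nat.zero_le r) hr) rfl
    (fun r _ _ => weight_antitone hγ0 s s (Nat.le_succ r))
  have hm := m_le_self hγ1 hs
  have h1 := one_le_minFalse hγ0 s s s
  have hw : 0 < weight γ s s s := by
    rw [weight, if_pos hm]
    exact inv_pos.2 (by exact_mod_cast (by omega : 0 < minFalse γ s s s))
  have he : extend a s = a s := if_neg (by omega)
  rw [he] at hsum
  have : (0 : ℝ) < s := by exact_mod_cast hs
  have := mul_pos has hw
  nlinarith

/-! ### The stepup procedure -/

variable {s : ℕ}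

theorem orderStat_mono (p : Fin s → ℝ) : Monotone (orderStat p) := Tuple.monotone_sort p

theorem numRejected_spec (c : ℕ → ℝ) (p : Fin s → ℝ) {j : Fin s} (hj : numRejected c p ≤ j) :
    c (j + 1) < orderStat p j :=
  Nat.sInf_mem (s := {r : ℕ | ∀ j : Fin s, r ≤ (j : ℕ) → c ((j : ℕ) + 1) < orderStat p j})
    ⟨s, fun j hj => absurd j.2 (by omega)⟩ j hj

theorem numRejected_le (c : ℕ → ℝ) (p : Fin s → ℝ) : numRejected c p ≤ s :=
  Nat.sInf_le fun j hj => absurd j.2 (by omega)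

theorem card_filter_lt {r : ℕ} (hr : r ≤ s) :
    (univ.filter fun j : Fin s => (j : ℕ) < r).card = r := by
  rw [Fin.card_filter_val_lt, min_eq_right hr]

theorem card_rejected (c : ℕ → ℝ) (p : Fin s → ℝ) : (rejected c p).card = numRejected c p := by
  rw [rejected, card_image_of_injective _ (Tuple.sort p).injective,
    card_filter_lt (numRejected_le c p)]

theorem le_of_mem_rejected (c : ℕ → ℝ) (p : Fin s → ℝ) {i : Fin s} (hi : i ∈ rejected c p) :
    p i ≤ c (numRejected c p) := by
  simp only [rejected, mem_image, mem_filter, mem_univ, true_and] at hi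
  obtain ⟨l, hl, rfl⟩ := hi
  -- By minimality r - 1 fails the defining condition; indices from r on satisfy it, so the failure
  -- is at the zero-based index r - 1.
  have hnot : ¬ ∀ j : Fin s, numRejected c p - 1 ≤ (j : ℕ) → c ((j : ℕ) + 1) < orderStat p j :=
    fun h => by
      have : numRejected c p ≤ numRejected c p - 1 := Nat.sInf_le h
      omega
  push Not at hnot
  obtain ⟨j, hj1, hj2⟩ := hnot
  have hj3 : (j : ℕ) < numRejected c p := by
    by_contra h
    exact absurd (numRejected_spec c p (not_lt.1 h)) (not_lt.2 hj2)
  rw [show (j : ℕ) + 1 = numRejected c p by omega] at hj2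
  exact (orderStat_mono p (Fin.le_def.2 (by omega) : l ≤ j)).trans hj2

/-- Strict separation makes A an initial segment of the sorted order, whatever the sort does with
ties. -/
theorem rejected_eq {c : ℕ → ℝ} {p : Fin s → ℝ} {A : Finset (Fin s)} (hA : 0 < A.card)
    (hle : ∀ i ∈ A, p i ≤ c A.card) (hlt : ∀ i ∈ A, ∀ j ∉ A, p i < p j)
    (hc : ∀ i ∉ A, ∀ l, 1 ≤ l → l ≤ s → c l < p i) : rejected c p = A := by
  have hAs : A.card ≤ s := by simpa using card_le_univ A
  set L : Finset (Fin s) := univ.filter fun j => Tuple.sort p j ∈ A with hL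
  have hLcard : L.card = A.card := by
    rw [← card_image_of_injective L (Tuple.sort p).injective]
    congr 1
    ext i
    simp only [hL, mem_image, mem_filter, mem_univ, true_and]
    refine ⟨?_, fun hi => ⟨(Tuple.sort p).symm i, by simpa using hi, by simp⟩⟩
    rintro ⟨j, hj, rfl⟩
    exact hj
  have hLlt : L = univ.filter fun j : Fin s => (j : ℕ) < A.card := by
    refine eq_of_subset_of_card_le (fun j hj => ?_) (by rw [card_filter_lt hAs, hLcard])
    have hsub : Iic j ⊆ L := fun l hl => by
      simp only [hL, mem_filter, mem_univ, true_and, mem_Iic] at hj hl ⊢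
      by_contra h
      exact absurd (hlt _ hj _ h) (not_lt.2 (orderStat_mono p hl))
    have := card_le_card hsub
    rw [Fin.card_Iic, hLcard] at this
    simp only [mem_filter, mem_univ, true_and]
    omega
  have hmem : ∀ j : Fin s, Tuple.sort p j ∈ A ↔ (j : ℕ) < A.card := fun j => by
    have := congrArg (j ∈ ·) hLlt
    simpa [hL] using this
  have hnum : numRejected c p = A.card := by
    refine le_antisymm (Nat.sInf_le fun j hj => hc _ (fun h => ?_) _ (Nat.le_add_left 1 j) j.2) ?_
    · exact absurd ((hmem j).1 h) (by omega)
    · by_contra h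
      have h1 := numRejected_spec c p (j := ⟨A.card - 1, by omega⟩) (Nat.le_sub_one_of_lt (not_le.1 h))
      have h2 := hle _ ((hmem ⟨A.card - 1, by omega⟩).2 (Nat.sub_lt hA one_pos))
      simp only [show A.card - 1 + 1 = A.card by omega] at h1
      exact absurd h1 (not_lt.2 h2)
  have : rejected c p = L.image (Tuple.sort p) := by rw [rejected, hnum, hLlt]
  rw [this]
  refine eq_of_subset_of_card_le (fun i hi => ?_)
    (by rw [card_image_of_injective _ (Tuple.sort p).injective, hLcard])
  simp only [hL, mem_image, mem_filter, mem_univ, true_and] at hi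
  obtain ⟨j, hj, rfl⟩ := hi
  exact hj

open Classical in
theorem lt_fdp_iff (c : ℕ → ℝ) {γ : ℝ} (hγ : 0 ≤ γ) (I : Set (Fin s)) (p : Fin s → ℝ) :
    γ < fdp c I p ↔ 0 < (rejected c p).card ∧
      m γ (rejected c p).card ≤ ((rejected c p).filter fun i => i ∈ I).card := by
  rw [m_le_iff, fdp]
  split_ifs with h
  · simp [h, hγ]
  · have h' : 0 < (rejected c p).card := Nat.pos_of_ne_zero h
    rw [lt_div_iff₀ (by exact_mod_cast h')]
    simp [h']

open Classical in
/-- If `FDP > γ`, then many true hypotheses have small p-values. -/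
theorem one_le_card_mul_weight {c : ℕ → ℝ} {γ : ℝ} (hγ : 0 ≤ γ) {I : Set (Fin s)}
    {p : Fin s → ℝ} (h : γ < fdp c I p) :
    ∃ r, 1 ≤ r ∧ r ≤ s ∧
      1 ≤ ((univ.filter fun i => i ∈ I ∧ p i ≤ c r).card : ℝ) *
        weight γ s (univ.filter fun i => i ∈ I).card r := by
  rw [lt_fdp_iff c hγ] at h
  obtain ⟨h0, hm⟩ := h
  rw [card_rejected] at h0 hm
  set n := (univ.filter fun i => i ∈ I).card with hn
  refine ⟨numRejected c p, h0, numRejected_le c p, ?_⟩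
  have hle : ((rejected c p).filter fun i => i ∈ I).card
      ≤ (univ.filter fun i => i ∈ I ∧ p i ≤ c (numRejected c p)).card :=
    card_le_card fun i hi => by
      simp only [mem_filter, mem_univ, true_and] at hi ⊢
      exact ⟨hi.2, le_of_mem_rejected c p hi.1⟩
  have hfn : ((rejected c p).filter fun i => i ∈ I).card ≤ n :=
    card_le_card (filter_subset_filter _ (subset_univ _))
  have h1 := card_filter_add_card_filter_not (s := rejected c p) (fun i => i ∈ I)
  have h2 : (univ.filter fun i => i ∈ I).card + (univ.filter fun i => ¬ i ∈ I).card = s := by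
    simpa using card_filter_add_card_filter_not (s := (univ : Finset (Fin s))) (fun i => i ∈ I)
  have h3 : ((rejected c p).filter fun i => ¬ i ∈ I).card ≤ (univ.filter fun i => ¬ i ∈ I).card :=
    card_le_card (filter_subset_filter _ (subset_univ _))
  rw [card_rejected] at h1
  have hk : minFalse γ s n (numRejected c p)
      ≤ (univ.filter fun i => i ∈ I ∧ p i ≤ c (numRejected c p)).card :=
    max_le (by omega) (by omega)
  have hk0 := one_le_minFalse hγ s n (numRejected c p)
  -- The cutoff is inactive: m(r) is at most the number of true rejections, hence at most n.
  rw [weight, if_pos (by omega), ← div_eq_mul_inv,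
    one_le_div (by exact_mod_cast (by omega : 0 < minFalse γ s n (numRejected c p)))]
  exact_mod_cast hk

end StepUp

/-! ### Control of the FDP -/

namespace TestingProblem

variable {s : ℕ} {𝒳 : Type*} [MeasurableSpace 𝒳]

/-- The endpoint u = 0 is reached by letting v decrease to u; critical values may be 0. -/
theorem ValidPValues.le_of_nonneg {T : TestingProblem s 𝒳} (hT : T.ValidPValues) {i : Fin s}
    {P : ProbabilityMeasure 𝒳} (hP : P ∈ T.null i) {u : ℝ} (hu : 0 ≤ u) :
    (P : Measure 𝒳).real {x | T.pval i x ≤ u} ≤ u := by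
  rcases le_or_gt 1 u with h1 | h1
  · exact measureReal_le_one.trans h1
  · refine le_of_forall_gt_imp_ge_of_dense fun v hv => ?_
    rcases le_or_gt 1 v with h2 | h2
    · exact measureReal_le_one.trans h2
    · exact (measureReal_mono fun x (hx : _ ≤ u) => hx.trans hv.le).trans
        (hT i P hP v ⟨hu.trans_lt hv, h2⟩)

end TestingProblem

namespace StepUp

open Finset

variable {s : ℕ}

open Classical in
theorem real_lt_fdp_le {𝒳 : Type*} [MeasurableSpace 𝒳] {T : TestingProblem s 𝒳}
    (hT : T.ValidPValues) (P : ProbabilityMeasure 𝒳) {γ : ℝ} (hγ : 0 ≤ γ) {c : ℕ → ℝ}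
    (hc : MonotoneOn c (Set.Icc 1 s)) (hc1 : 0 ≤ c 1) :
    (P : Measure 𝒳).real {x | γ < fdp c (T.trueNulls P) (fun i => T.pval i x)} ≤
      (univ.filter fun i => i ∈ T.trueNulls P).card * ∑ r ∈ range s,
        (extend c (r + 1) - extend c r) *
          weight γ s (univ.filter fun i => i ∈ T.trueNulls P).card (r + 1) := by
  set I := univ.filter fun i => i ∈ T.trueNulls P with hI
  set w := weight γ s I.card with hw
  have hw0 : ∀ r, 0 ≤ w r := weight_nonneg hγ s _
  have hwa : ∀ r, w (r + 1) ≤ w r := fun r => weight_antitone hγ s _ (Nat.le_succ r)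
  -- The value c 0 is unconstrained, so index 0 is set to 0 by hand, as in `extend`.
  let N : ℕ → 𝒳 → ℝ := fun r x =>
    if r = 0 then 0 else ∑ i ∈ I, Set.indicator {x | T.pval i x ≤ c r} 1 x
  let e : ℕ → ℝ := fun r =>
    if r = 0 then 0 else ∑ i ∈ I, (P : Measure 𝒳).real {x | T.pval i x ≤ c r}
  have hmeas : ∀ i r, MeasurableSet {x | T.pval i x ≤ c r} := fun i r =>
    measurableSet_le (T.measurable_pval i) measurable_const
  have hint : ∀ i r, Integrable (Set.indicator {x | T.pval i x ≤ c r} (1 : 𝒳 → ℝ))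
      (P : Measure 𝒳) := fun i r => (integrable_const (1 : ℝ)).indicator (hmeas i r)
  have hNint : ∀ r, Integrable (N r) (P : Measure 𝒳) := fun r => by
    by_cases hr : r = 0
    · simp [N, hr]
    · simp only [N, hr, if_false]
      exact integrable_finsetSum _ fun i _ => hint i r
  have hNe : ∀ r, ∫ x, N r x ∂(P : Measure 𝒳) = e r := fun r => by
    by_cases hr : r = 0
    · simp [N, e, hr]
    · simp only [N, e, hr, if_false]
      rw [integral_finsetSum _ fun i _ => hint i r]
      exact sum_congr rfl fun i _ => integral_indicator_one (hmeas i r)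
  have hN0 : ∀ r x, 0 ≤ N r x := fun r x => by
    simp only [N]
    split_ifs
    · rfl
    · exact sum_nonneg fun i _ => Set.indicator_nonneg (fun _ _ => zero_le_one) x
  have hNmono : ∀ r < s, ∀ x, N r x ≤ N (r + 1) x := fun r hr x => by
    by_cases hr0 : r = 0
    · simpa [N, hr0] using hN0 (r + 1) x
    · simp only [N, hr0, if_false, Nat.succ_ne_zero]
      refine sum_le_sum fun i _ => Set.indicator_le_indicator_of_subset
        (fun y (hy : _ ≤ c r) => hy.trans (hc ⟨by omega, by omega⟩ ⟨by omega, by omega⟩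
          (Nat.le_succ r))) (fun _ => zero_le_one) x
  let g : 𝒳 → ℝ := fun x => ∑ r ∈ range s, (N (r + 1) x - N r x) * w (r + 1)
  have hg0 : ∀ x, 0 ≤ g x := fun x => sum_nonneg fun r hr =>
    mul_nonneg (sub_nonneg.2 (hNmono r (mem_range.1 hr) x)) (hw0 _)
  have hgint : Integrable g (P : Measure 𝒳) :=
    integrable_finsetSum _ fun r _ => ((hNint _).sub (hNint _)).mul_const _
  have hgE : ∫ x, g x ∂(P : Measure 𝒳) = ∑ r ∈ range s, (e (r + 1) - e r) * w (r + 1) := by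
    refine (integral_finsetSum _ fun r _ => ((hNint (r + 1)).sub (hNint r)).mul_const _).trans ?_
    refine sum_congr rfl fun r _ => ?_
    simp only [Pi.sub_apply]
    rw [integral_mul_const, integral_sub (hNint _) (hNint _), hNe, hNe]
  have hsub : {x | γ < fdp c (T.trueNulls P) (fun i => T.pval i x)} ⊆ {x | 1 ≤ g x} := by
    intro x hx
    obtain ⟨r, hr1, hrs, hr⟩ := one_le_card_mul_weight hγ hx
    have hNr : N r x =
        (univ.filter fun i => i ∈ T.trueNulls P ∧ T.pval i x ≤ c r).card := by
      simp only [N, show r ≠ 0 by omega, if_false]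
      rw [← filter_filter, ← hI, card_filter]
      push_cast
      exact sum_congr rfl fun i _ => by simp [Set.indicator_apply]
    rw [← hNr] at hr
    refine hr.trans ((mul_le_sum_increments_mul (fun r => N r x) w r (fun _ _ => hN0 _ _)
      (by simp [N]) (fun r _ _ => hwa r)).trans ?_)
    exact sum_le_sum_of_subset_of_nonneg (range_subset_range.2 hrs) fun q hq _ =>
      mul_nonneg (sub_nonneg.2 (hNmono q (mem_range.1 hq) x)) (hw0 _)
  have hmarkov := mul_meas_ge_le_integral_of_nonneg (μ := (P : Measure 𝒳))
    (Filter.Eventually.of_forall hg0) hgint 1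
  rw [one_mul, hgE] at hmarkov
  refine (measureReal_mono hsub).trans (hmarkov.trans ?_)
  -- Second summation by parts, applied to the slack n c_r - E N_r, which validity makes
  -- nonnegative.
  have hd : ∀ r ≤ s, 0 ≤ I.card * extend c r - e r := fun r hr => by
    have h0 := extend_mono hc hc1 (Nat.zero_le r) hr
    by_cases hr0 : r = 0
    · simp [e, hr0, extend]
    · simp only [e, extend, hr0, if_false, if_true] at h0 ⊢
      rw [sub_nonneg, ← nsmul_eq_mul]
      exact sum_le_card_nsmul _ _ _ fun i hi => hT.le_of_nonneg (mem_filter.1 hi).2 h0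
  have habel := mul_le_sum_increments_mul (fun r => I.card * extend c r - e r) w s hd
    (by simp [extend, e]) (fun r _ _ => hwa r)
  have hlast := mul_nonneg (hd s le_rfl) (hw0 s)
  have := hlast.trans habel
  rw [mul_sum, ← sub_nonneg, ← sum_sub_distrib]
  refine this.trans_eq (sum_congr rfl fun r _ => by ring)

theorem controlsFDP_one {𝒳 : Type*} [MeasurableSpace 𝒳] (T : TestingProblem s 𝒳) (c : ℕ → ℝ)
    {α : ℝ} (hα : 0 ≤ α) : ControlsFDP c 1 α T := by
  classical
  intro P _
  have : {x | 1 < fdp c (T.trueNulls P) (fun i => T.pval i x)} = ∅ := by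
    refine Set.eq_empty_of_forall_notMem fun x (hx : 1 < fdp _ _ _) => absurd hx (not_lt.2 ?_)
    unfold fdp
    split_ifs
    · exact zero_le_one
    · exact div_le_one_of_le₀ (by exact_mod_cast card_filter_le _ _) (Nat.cast_nonneg _)
  rw [this]
  simpa using hα

theorem controlsFDP_D2 {𝒳 : Type*} [MeasurableSpace 𝒳] {T : TestingProblem s 𝒳}
    (hT : T.ValidPValues) {a : ℕ → ℝ} {γ α : ℝ} (hs : 1 ≤ s) (hγ0 : 0 ≤ γ) (hγ1 : γ < 1)
    (hα : 0 ≤ α) (ha : MonotoneOn a (Set.Icc 1 s)) (ha1 : 0 ≤ a 1) (has : 0 < a s) :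
    ControlsFDP (fun i => α * a i / D2 a γ s hs) γ α T := by
  classical
  intro P _
  have hD := D2_pos hs hγ0 hγ1 ha ha1 has
  have hcoef : 0 ≤ α / D2 a γ s hs := by positivity
  have hceq : ∀ i, α * a i / D2 a γ s hs = α / D2 a γ s hs * a i := fun i => by ring
  refine (real_lt_fdp_le hT P hγ0 (fun i hi j hj hij => ?_) ?_).trans ?_
  · simp only [hceq]
    exact mul_le_mul_of_nonneg_left (ha hi hj hij) hcoef
  · rw [hceq]
    exact mul_nonneg hcoef ha1
  set n := (univ.filter fun i => i ∈ T.trueNulls P).card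
  have hns : n ≤ s := by simpa using card_le_univ (univ.filter fun i => i ∈ T.trueNulls P)
  rcases Nat.eq_zero_or_pos n with h0 | hn
  · simpa [h0] using hα
  · have hext : ∀ r, extend (fun i => α * a i / D2 a γ s hs) r
        = α / D2 a γ s hs * extend a r := fun r => by
      simp only [extend]
      split_ifs <;> ring
    have hS := S2_eq a hγ0 hγ1 hn hns
    have hle := S2_le_D2 a γ hs hn hns
    calc _ = α / D2 a γ s hs * S2 a γ s n := by
          rw [hS, mul_sum, mul_sum, mul_sum]
          exact sum_congr rfl fun r _ => by rw [hext, hext]; ring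
      _ ≤ α / D2 a γ s hs * D2 a γ s hs := mul_le_mul_of_nonneg_left hle hcoef
      _ = α := div_mul_cancel₀ _ hD.ne'

end StepUp

/-! ### Sharpness -/

open Finset in
/-- Nonnegative weights of total mass one on a finite set define a probability measure. -/
theorem exists_probabilityMeasure_real_eq_sum {Ω : Type*} [Fintype Ω] [MeasurableSpace Ω]
    [DiscreteMeasurableSpace Ω] (w : Ω → ℝ) (hw : ∀ x, 0 ≤ w x) (h1 : ∑ x, w x = 1) :
    ∃ P : ProbabilityMeasure Ω, ∀ S : Set Ω,
      (P : Measure Ω).real S = ∑ x, S.indicator w x := by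
  have hval : ∀ S : Set Ω, (∑ x, ENNReal.ofReal (w x) • Measure.dirac x : Measure Ω) S =
      ENNReal.ofReal (∑ x, S.indicator w x) := fun S => by
    rw [Measure.finsetSum_apply,
      ENNReal.ofReal_sum_of_nonneg fun x _ => Set.indicator_nonneg (fun y _ => hw y) x]
    refine sum_congr rfl fun x _ => ?_
    by_cases hx : x ∈ S <;> simp [hx]
  refine ⟨⟨∑ x, ENNReal.ofReal (w x) • Measure.dirac x, ⟨?_⟩⟩, fun S => ?_⟩
  · rw [hval]
    simp [h1]
  · rw [measureReal_def, ProbabilityMeasure.coe_mk, hval, ENNReal.toReal_ofReal]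
    exact sum_nonneg fun x _ => Set.indicator_nonneg (fun y _ => hw y) x

-- As z runs over a full period, i + z meets each residue once.
open Finset in
theorem card_filter_add_mod_lt {n k : ℕ} (i : ℕ) (hk : k ≤ n) :
    ((range n).filter fun z => (i + z) % n < k).card = k := by
  have h1 : ((range n).filter fun z => (i + z) % n < k).card =
      ((Ico i (i + n)).filter fun x => x % n < k).card := by
    rw [card_filter, card_filter, sum_Ico_eq_sum_range, Nat.add_sub_cancel_left]
  rw [h1, Nat.filter_Ico_card_eq_of_periodic i n _ fun x => by simp, Nat.count_eq_card_filter_range]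
  have h2 : (range n).filter (fun x => x % n < k) = range k := by
    ext x
    simp only [mem_filter, mem_range]
    constructor
    · rintro ⟨h, h'⟩
      rwa [Nat.mod_eq_of_lt h] at h'
    · intro h
      exact ⟨by omega, by rwa [Nat.mod_eq_of_lt (by omega)]⟩
  rw [h2, card_range]

-- The terms kept telescope. Carrying both bounds, u and e k, closes the induction.
open Finset in
theorem sum_increments_le {e : ℕ → ℝ} {u : ℝ} (hu : 0 ≤ u) (he0 : e 0 = 0) (k : ℕ)
    (he : ∀ r < k, e r ≤ e (r + 1)) :
    ∑ r ∈ range k, (if e (r + 1) ≤ u then e (r + 1) - e r else 0) ≤ min u (e k) := by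
  induction k with
  | zero => simp [hu, he0]
  | succ k ih =>
    have h1 := ih fun r hr => he r (by omega)
    have h2 := he k (by omega)
    rw [le_min_iff] at h1 ⊢
    rw [sum_range_succ]
    split_ifs with h
    · constructor <;> linarith
    · constructor <;> linarith

/-! ### The least favourable configuration -/

namespace StepUp

open Finset

variable {s : ℕ}

/-- The p-values of a least favourable configuration with true hypotheses `i < n`. In the state
`(some r, z)` exactly `k (r + 1)` of the true hypotheses, forming a cyclic window with offset `z`,
have p-value `b (r + 1)`, exactly `r + 1 - k (r + 1)` of the false ones have p-value `0`, and
all other p-values are `1`. -/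
noncomputable def windowPVal (b : ℕ → ℝ) (k : ℕ → ℕ) (n : ℕ) (i : Fin s) :
    Option (Fin s) × Fin n → ℝ
  | (none, _) => 1
  | (some r, z) =>
    if (i : ℕ) < n then if ((i : ℕ) + z) % n < k (r + 1) then b (r + 1) else 1
    else if (i : ℕ) - n + k (r + 1) < r + 1 then 0 else 1

theorem card_filter_window {n k : ℕ} (z : ℕ) (hk : k ≤ n) (hns : n ≤ s) :
    (univ.filter fun i : Fin s => (i : ℕ) < n ∧ ((i : ℕ) + z) % n < k).card = k := by
  rw [card_filter, Fin.sum_univ_eq_sum_range (fun i => if i < n ∧ (i + z) % n < k then 1 else 0) s,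
    ← card_filter]
  refine Eq.trans (congrArg card ?_) (card_filter_add_mod_lt z hk)
  ext i
  simp only [mem_filter, mem_range, add_comm z i]
  exact ⟨fun h => h.2, fun h => ⟨by omega, h⟩⟩

theorem card_filter_sub_add_lt {n k r : ℕ} (hk : k ≤ r) (hr : n + r ≤ s + k) :
    (univ.filter fun i : Fin s => ¬ (i : ℕ) < n ∧ (i : ℕ) - n + k < r).card = r - k := by
  rw [card_filter,
    Fin.sum_univ_eq_sum_range (fun i => if ¬ i < n ∧ i - n + k < r then 1 else 0) s, ← card_filter]
  have h : (range s).filter (fun i => ¬ i < n ∧ i - n + k < r) = Ico n (n + (r - k)) := by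
    ext i
    simp only [mem_filter, mem_range, mem_Ico]
    omega
  rw [h, Nat.card_Ico, Nat.add_sub_cancel_left]

/-- Exactly r + 1 p-values are at most c (r + 1), and k (r + 1) of them are true. The rest equal 1,
above every critical value. -/
theorem lt_fdp_windowPVal {b c : ℕ → ℝ} {k : ℕ → ℕ} {n : ℕ} {γ : ℝ} (hγ : 0 ≤ γ) (hns : n ≤ s)
    (hc : ∀ l, 1 ≤ l → l ≤ s → 0 ≤ b l ∧ b l ≤ c l ∧ c l < 1) (r : Fin s) (z : Fin n)
    (hkn : k (r + 1) ≤ n) (hkr : k (r + 1) ≤ r + 1) (hks : n + (r + 1) ≤ s + k (r + 1))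
    (hm : m γ (r + 1) ≤ k (r + 1)) :
    γ < fdp c {i : Fin s | (i : ℕ) < n} (fun i => windowPVal b k n i (some r, z)) := by
  classical
  have h1 := card_filter_window (s := s) (z : ℕ) hkn hns
  have h2 := card_filter_sub_add_lt (s := s) hkr hks
  obtain ⟨hb0, hbc, hc1⟩ := hc (r + 1) (by omega) r.2
  set A : Finset (Fin s) := univ.filter fun i =>
    if (i : ℕ) < n then ((i : ℕ) + z) % n < k (r + 1) else (i : ℕ) - n + k (r + 1) < r + 1 with hA
  have hA1 : A.filter (fun i : Fin s => (i : ℕ) < n) =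
      univ.filter fun i : Fin s => (i : ℕ) < n ∧ ((i : ℕ) + z) % n < k (r + 1) := by
    ext i
    simp only [hA, mem_filter, mem_univ, true_and]
    split_ifs <;> tauto
  have hA2 : A.filter (fun i : Fin s => ¬ (i : ℕ) < n) =
      univ.filter fun i : Fin s => ¬ (i : ℕ) < n ∧ (i : ℕ) - n + k (r + 1) < r + 1 := by
    ext i
    simp only [hA, mem_filter, mem_univ, true_and]
    split_ifs <;> tauto
  have hAcard : A.card = r + 1 := by
    have := card_filter_add_card_filter_not (s := A) (fun i : Fin s => (i : ℕ) < n)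
    rw [hA1, hA2, h1, h2] at this
    omega
  have hin : ∀ i ∈ A, windowPVal b k n i (some r, z) ≤ c (r + 1) := fun i hi => by
    simp only [hA, mem_filter, mem_univ, true_and] at hi
    simp only [windowPVal]
    split_ifs at hi ⊢
    · exact hbc
    · exact hb0.trans hbc
  have hout : ∀ i ∉ A, windowPVal b k n i (some r, z) = 1 := fun i hi => by
    simp only [hA, mem_filter, mem_univ, true_and] at hi
    simp only [windowPVal]
    split_ifs at hi ⊢ <;> rfl
  have hrej : rejected c (fun i => windowPVal b k n i (some r, z)) = A :=
    rejected_eq (by omega) (by rwa [hAcard])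
      (fun i hi j hj => by
        simp only [hout j hj]
        exact (hin i hi).trans_lt hc1)
      (fun i hi l hl1 hl2 => by
        simp only [hout i hi]
        exact (hc l hl1 hl2).2.2)
  rw [lt_fdp_iff c hγ, hrej, hAcard]
  refine ⟨by omega, ?_⟩
  refine hm.trans_eq ?_
  rw [← h1, ← hA1]
  congr!

/-- The upper bound for `P {FDP > γ}` is attained. -/
theorem exists_le_real_lt_fdp {a c : ℕ → ℝ} {γ β : ℝ} {n : ℕ} (hγ0 : 0 ≤ γ) (hγ1 : γ < 1)
    (hn : 1 ≤ n) (hns : n ≤ s) (ha : MonotoneOn a (Set.Icc 1 s)) (ha1 : 0 ≤ a 1) (hβ : 0 ≤ β)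
    (hS : β * S2 a γ s n ≤ 1)
    (hc : ∀ l, 1 ≤ l → l ≤ s → β * a l ≤ c l ∧ c l < 1) :
    ∃ (𝒳 : Type) (_ : MeasurableSpace 𝒳) (T : TestingProblem s 𝒳), T.ValidPValues ∧
      (∀ i x, T.pval i x ∈ Set.Icc (0 : ℝ) 1) ∧ ∃ P ∈ T.model, β * S2 a γ s n ≤
        (P : Measure 𝒳).real {x | γ < fdp c (T.trueNulls P) (fun i => T.pval i x)} := by
  classical
  set b : ℕ → ℝ := fun r => β * extend a r with hb
  have hb_mono : ∀ r < s, b r ≤ b (r + 1) := fun r hr =>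
    mul_le_mul_of_nonneg_left (extend_mono ha ha1 (Nat.le_succ r) hr) hβ
  have hb_c : ∀ l, 1 ≤ l → l ≤ s → 0 ≤ b l ∧ b l ≤ c l ∧ c l < 1 := fun l hl hls => by
    have h0 := extend_mono ha ha1 (Nat.zero_le l) hls
    have h1 := hc l hl hls
    have h2 : extend a l = a l := if_neg (by omega)
    refine ⟨mul_nonneg hβ (by simpa [extend] using h0), ?_, h1.2⟩
    simpa only [hb, h2] using h1.1
  set k : ℕ → ℕ := fun r => (minFalse γ s n r).toNat with hk
  -- Mass of one state (some r, z). A true p-value is in the window for k (r + 1) of the n offsets,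
  -- so the factor k cancels the weight and leaves the increment of b.
  set v : ℕ → ℝ := fun r => (b (r + 1) - b r) * weight γ s n (r + 1) with hv
  have hn' : (0 : ℝ) < n := by exact_mod_cast hn
  have hv0 : ∀ r < s, 0 ≤ v r := fun r hr =>
    mul_nonneg (sub_nonneg.2 (hb_mono r hr)) (weight_nonneg hγ0 _ _ _)
  have hvS : n * ∑ r : Fin s, v r = β * S2 a γ s n := by
    rw [S2_eq a hγ0 hγ1 hn hns, Fin.sum_univ_eq_sum_range v s, mul_sum, mul_sum, mul_sum]
    exact sum_congr rfl fun r _ => by simp only [hv, hb]; ring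
  -- The leftover mass 1 - β S₂ goes to states where all p-values are 1.
  let w : Option (Fin s) × Fin n → ℝ := fun x =>
    x.1.elim ((1 - β * S2 a γ s n) / n) (fun r => v r)
  have hsum : ∀ f : Option (Fin s) × Fin n → ℝ,
      ∑ x, f x = ∑ z, f (none, z) + ∑ r, ∑ z, f (some r, z) := fun f => by
    rw [Fintype.sum_prod_type, Fintype.sum_option]
  have hw0 : ∀ x, 0 ≤ w x := by
    rintro ⟨_ | r, z⟩
    · exact div_nonneg (sub_nonneg.2 hS) hn'.le
    · exact hv0 r r.2
  have hw1 : ∑ x, w x = 1 := by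
    rw [hsum]
    simp only [w, Option.elim, sum_const, card_univ, Fintype.card_fin, nsmul_eq_mul]
    rw [← mul_sum, hvS, mul_div_cancel₀ _ hn'.ne']
    ring
  let _ : MeasurableSpace (Option (Fin s) × Fin n) := ⊤
  have _ : DiscreteMeasurableSpace (Option (Fin s) × Fin n) := ⟨fun _ => trivial⟩
  obtain ⟨P, hP⟩ := exists_probabilityMeasure_real_eq_sum w hw0 hw1
  let T : TestingProblem s (Option (Fin s) × Fin n) :=
    { model := {P}
      null := fun i => {Q | Q = P ∧ (i : ℕ) < n}
      null_subset := fun i Q hQ => hQ.1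
      pval := windowPVal b k n
      measurable_pval := fun i => measurable_from_top }
  have hT : T.trueNulls P = {i : Fin s | (i : ℕ) < n} := by
    ext i
    simp [TestingProblem.trueNulls, T]
  have hkspec : ∀ r : Fin s, m γ (r + 1) ≤ n → k (r + 1) ≤ n ∧ k (r + 1) ≤ r + 1 ∧
      n + (r + 1) ≤ s + k (r + 1) ∧ m γ (r + 1) ≤ k (r + 1) ∧
      ((k (r + 1) : ℕ) : ℤ) = minFalse γ s n (r + 1) ∧ 1 ≤ k (r + 1) := fun r hr => by
    have h1 := one_le_m hγ0 ((r : ℕ) + 1)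
    have h2 := m_le_self hγ1 (Nat.le_add_left 1 (r : ℕ))
    have h3 := r.2
    simp only [hk, minFalse]
    push_cast at h2 ⊢
    omega
  refine ⟨Option (Fin s) × Fin n, ⊤, T, ?_, ?_, P, rfl, ?_⟩
  · rintro i Q ⟨rfl, hi⟩ u ⟨hu0, hu1⟩
    rw [hP, hsum]
    have hnone : ∀ z, Set.indicator {x | windowPVal b k n i x ≤ u} w (none, z) = 0 := fun z =>
      Set.indicator_of_notMem (by simpa [windowPVal] using hu1) _
    have hsome : ∀ r : Fin s,
        ∑ z, Set.indicator {x | windowPVal b k n i x ≤ u} w (some r, z) ≤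
          if b (r + 1) ≤ u then b (r + 1) - b r else 0 := fun r => by
      have hz : ∀ z : Fin n, Set.indicator {x | windowPVal b k n i x ≤ u} w (some r, z) =
          if ((i : ℕ) + z) % n < k (r + 1) then (if b (r + 1) ≤ u then v r else 0) else 0 :=
        fun z => by
          simp only [Set.indicator_apply, Set.mem_ofPred_eq, windowPVal, hi, if_true, w, Option.elim]
          split_ifs <;> first | rfl | (exfalso; linarith)
      simp only [hz]
      rw [Fin.sum_univ_eq_sum_range (fun z => if ((i : ℕ) + z) % n < k (r + 1) then
        (if b (r + 1) ≤ u then v r else 0) else 0) n, ← sum_filter, sum_const]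
      have hbr := hb_mono r r.2
      by_cases hm : m γ (r + 1) ≤ n
      · obtain ⟨hkn, -, -, -, hkm, hk1⟩ := hkspec r hm
        rw [card_filter_add_mod_lt _ hkn]
        split_ifs
        · have hk1' : (0 : ℝ) < k (r + 1) := by exact_mod_cast hk1
          have hcast : (minFalse γ s n (r + 1) : ℝ) = k (r + 1) := by
            rw [← hkm, Int.cast_natCast]
          simp only [hv, weight, hm, if_true, hcast, nsmul_eq_mul]
          rw [mul_left_comm, mul_inv_cancel₀ hk1'.ne', mul_one]
        · simp
      · have hv' : v r = 0 := by simp [hv, weight, hm]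
        rw [hv', ite_self, smul_zero]
        split_ifs
        · linarith
        · rfl
    simp only [T, hnone, sum_const_zero, zero_add]
    refine (sum_le_sum fun r _ => hsome r).trans ?_
    rw [Fin.sum_univ_eq_sum_range (fun r => if b (r + 1) ≤ u then b (r + 1) - b r else 0) s]
    exact (sum_increments_le hu0.le (by simp [hb, extend]) s hb_mono).trans (min_le_left _ _)
  · rintro i ⟨_ | r, z⟩
    · simp [T, windowPVal]
    · obtain ⟨h0, h1, h2⟩ := hb_c (r + 1) (by omega) r.2
      simp only [T, windowPVal]
      split_ifs
      · exact ⟨h0, h1.trans h2.le⟩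
      · simp
      · simp
      · simp
  · rw [hP, hT, hsum, ← hvS, mul_sum]
    refine le_add_of_nonneg_of_le
      (sum_nonneg fun z _ => Set.indicator_nonneg (fun x _ => hw0 x) _)
      (sum_le_sum fun r _ => ?_)
    by_cases hm : m γ (r + 1) ≤ n
    · obtain ⟨hkn, hkr, hks, hmk, -, -⟩ := hkspec r hm
      have hz : ∀ z : Fin n, Set.indicator {x | γ < fdp c {i : Fin s | (i : ℕ) < n}
          (fun i => T.pval i x)} w (some r, z) = v r := fun z =>
        Set.indicator_of_mem (by
          rw [Set.mem_ofPred_eq]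
          exact lt_fdp_windowPVal hγ0 hns hb_c r z hkn hkr hks hmk) w
      simp only [hz, sum_const, card_univ, Fintype.card_fin, nsmul_eq_mul, le_refl]
    · have hv' : v r = 0 := by simp [hv, weight, hm]
      rw [hv', mul_zero]
      exact sum_nonneg fun z _ => Set.indicator_nonneg (fun x _ => hw0 x) _

/-- Constant p-values `1` show that critical values `≥ 1` do not control the FDP. -/
theorem lt_one_of_forall_controlsFDP {c : ℕ → ℝ} {γ α : ℝ} (hs : 1 ≤ s) (hγ0 : 0 ≤ γ)
    (hγ1 : γ < 1) (hα : α < 1)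
    (h : ∀ (𝒳 : Type) [MeasurableSpace 𝒳] (T : TestingProblem s 𝒳), T.ValidPValues →
      (∀ i x, T.pval i x ∈ Set.Icc (0 : ℝ) 1) → ControlsFDP c γ α T) : c s < 1 := by
  classical
  by_contra! hcs
  let P : ProbabilityMeasure Unit := ⟨Measure.dirac (), inferInstance⟩
  let T : TestingProblem s Unit :=
    { model := Set.univ
      null := fun _ => Set.univ
      null_subset := fun _ => subset_rfl
      pval := fun _ _ => 1
      measurable_pval := fun _ => measurable_const }
  have hT : T.ValidPValues := by
    rintro i Q - u ⟨hu0, hu1⟩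
    have : {x : Unit | T.pval i x ≤ u} = ∅ :=
      Set.eq_empty_of_forall_notMem fun x hx => absurd hu1 (not_lt.2 hx)
    rw [this]
    simpa using hu0.le
  have hP := h Unit T hT (fun i x => by simp [T]) P trivial
  have hev : {x : Unit | γ < fdp c (T.trueNulls P) (fun i => T.pval i x)} = Set.univ := by
    refine Set.eq_univ_of_forall fun x => ?_
    have hrej : rejected c (fun i => T.pval i x) = (univ : Finset (Fin s)) :=
      rejected_eq (by simp; omega) (fun _ _ => by simpa [T] using hcs) (fun _ _ j hj => absurd (mem_univ j) hj)
        (fun j hj => absurd (mem_univ j) hj)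
    have htrue : T.trueNulls P = Set.univ := Set.eq_univ_of_forall fun _ => trivial
    rw [Set.mem_ofPred_eq, lt_fdp_iff c hγ0, hrej, htrue]
    simpa using ⟨by omega, m_le_self hγ1 hs⟩
  rw [hev] at hP
  simp at hP
  linarith

theorem D2_le_of_forall_controlsFDP {a : ℕ → ℝ} {γ α D' : ℝ} (hs : 1 ≤ s) (hγ0 : 0 ≤ γ)
    (hγ1 : γ < 1) (hα0 : 0 < α) (hα1 : α < 1) (ha : MonotoneOn a (Set.Icc 1 s)) (ha1 : 0 ≤ a 1)
    (has : 0 < a s) (hD' : 0 < D')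
    (h : ∀ (𝒳 : Type) [MeasurableSpace 𝒳] (T : TestingProblem s 𝒳), T.ValidPValues →
      (∀ i x, T.pval i x ∈ Set.Icc (0 : ℝ) 1) → ControlsFDP (fun i => α * a i / D') γ α T) :
    D2 a γ s hs ≤ D' := by
  by_contra! hlt
  have hcs := lt_one_of_forall_controlsFDP hs hγ0 hγ1 hα1 h
  have hD := D2_pos hs hγ0 hγ1 ha ha1 has
  obtain ⟨n, hn, hDn⟩ := exists_mem_eq_sup' (nonempty_Icc.2 hs) (fun n => S2 a γ s n)
  rw [mem_Icc] at hn
  change D2 a γ s hs = S2 a γ s n at hDn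
  have hnonneg : ∀ l, 1 ≤ l → l ≤ s → 0 ≤ a l := fun l hl hls =>
    ha1.trans (ha ⟨le_rfl, hs⟩ ⟨hl, hls⟩ hl)
  -- The natural choice β = α/D' could make the total mass β D₂ exceed 1, so β is capped at 1/D₂.
  -- Either way β D₂ > α, because D' < D₂ and α < 1.
  obtain ⟨𝒳, _, T, hT, hT01, P, hPm, hP⟩ := exists_le_real_lt_fdp
    (β := min (α / D') (1 / D2 a γ s hs)) (c := fun i => α * a i / D') hγ0 hγ1 hn.1 hn.2 ha ha1
    (by positivity)
    (by
      rw [← hDn]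
      calc _ ≤ 1 / D2 a γ s hs * D2 a γ s hs := mul_le_mul_of_nonneg_right (min_le_right _ _) hD.le
        _ = 1 := div_mul_cancel₀ _ hD.ne')
    (fun l hl hls => by
      constructor
      · rw [mul_div_right_comm]
        exact mul_le_mul_of_nonneg_right (min_le_left _ _) (hnonneg l hl hls)
      · refine lt_of_le_of_lt ?_ hcs
        have := ha ⟨hl, hls⟩ ⟨hs, le_rfl⟩ hls
        gcongr)
  have hle := hP.trans (h 𝒳 T hT hT01 P hPm)
  rw [← hDn] at hle
  refine absurd hle (not_le.2 ?_)
  rw [min_mul_of_nonneg _ _ hD.le, lt_min_iff, div_mul_cancel₀ _ hD.ne', div_mul_eq_mul_div,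
    lt_div_iff₀ hD']
  exact ⟨mul_lt_mul_of_pos_left hlt hα0, hα1⟩

end StepUp

theorem theorem4p1 (s : ℕ) (hs : 1 ≤ s) (γ α : ℝ) (hγ0 : 0 ≤ γ) (hγ1 : γ ≤ 1)
    (hα0 : 0 < α) (hα1 : α < 1)
    (a : ℕ → ℝ) (ha : MonotoneOn a (Set.Icc 1 s)) (ha1 : 0 ≤ a 1) (has : 0 < a s) :
    -- the normalizing constant is positive
    (γ < 1 → 0 < StepUp.D2 a γ s hs) ∧
    -- (i) control of the FDP
    (∀ (𝒳 : Type*) [MeasurableSpace 𝒳] (T : TestingProblem s 𝒳), T.ValidPValues →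
      StepUp.ControlsFDP (fun i => α * a i / StepUp.D2 a γ s hs) γ α T) ∧
    -- (ii) weak optimality; control is only required for p-values with values in [0, 1]
    (γ < 1 → ∀ D' : ℝ, 0 < D' →
      (∀ (𝒳 : Type) [MeasurableSpace 𝒳] (T : TestingProblem s 𝒳), T.ValidPValues →
        (∀ i x, T.pval i x ∈ Set.Icc (0 : ℝ) 1) →
        StepUp.ControlsFDP (fun i => α * a i / D') γ α T) →
      StepUp.D2 a γ s hs ≤ D' ∧
        ∀ i ∈ Set.Icc 1 s, α * a i / D' ≤ α * a i / StepUp.D2 a γ s hs) := by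
  refine ⟨fun hγ => StepUp.D2_pos hs hγ0 hγ ha ha1 has, fun 𝒳 _ T hT => ?_,
    fun hγ D' hD' h => ?_⟩
  · rcases hγ1.lt_or_eq with hγ | rfl
    · exact StepUp.controlsFDP_D2 hT hs hγ0 hγ hα0.le ha ha1 has
    -- An FDP never exceeds 1, so the critical values are irrelevant, including the value 0 given by
    -- division by D₂ = 0.
    · exact StepUp.controlsFDP_one T _ hα0.le
  · have hD := StepUp.D2_le_of_forall_controlsFDP hs hγ0 hγ hα0 hα1 ha ha1 has hD' h
    refine ⟨hD, fun i hi => ?_⟩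
    have hai : 0 ≤ a i := ha1.trans (ha ⟨le_rfl, hs⟩ hi hi.1)
    exact div_le_div_of_nonneg_left (mul_nonneg hα0.le hai)
      (StepUp.D2_pos hs hγ0 hγ ha ha1 has) hD
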